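/- Let $H$ be a real Hilbert space, $N\ge 2$, $X=H^N$, $q=\tfrac12\|\cdot\|^2$ and $c(x_1,\dots,x_N)=\sum_{1\le i<j\le N}\langle x_i,x_j\rangle$. Let $f_1,\dots,f_N:H\to(-\infty,+\infty]$ be convex, lower semicontinuous and proper, with $c(x)\le\sum_{i=1}^N f_i(x_i)$ for all $x\in X$, and suppose that the $c$-splitting set generated by $(f_1,\dots,f_N)$, namely $$\Gamma=\Big\{x\in X : c(x)=\sum_{i=1}^N f_i(x_i)\Big\},$$ is nonempty. For $1\le i\le N$ let $A_i:H\rightrightarrows H$ be the set-valued mapping with graph $\{(x_i,\sum_{j\ne i}x_j) : x\in\Gamma\}$. Write $\partial f$ for the subdifferential, $f^*(u)=\sup_{x}(\langle u,x\rangle-f(x))$, $e_f(s)=\inf_x(f(x)+q(s-x))$, and $\operatorname{prox}_f(s)$ for the unique minimizer of $y\mapsto f(y)+q(y-s)$. Then the following are equivalent: (i) $A_{i_0}$ is maximally monotone for some $1\le i_0\le N$; (ii) $A_{i_0}=\partial f_{i_0}$ for some $1\le i_0\le N$; (iii) $A_i=\partial f_i$ for every $1\le i\le N$; (iv) $\operatorname{prox}_{f_1}+\dots+\operatorname{prox}_{f_N}=\mathrm{Id}$;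 (v) $e_{f_1^*}+\dots+e_{f_N^*}=q$. Call $\Gamma'\subseteq X$ $n$-$c$-monotone if $\sum_{j=1}^n c(x_1^{\sigma_1(j)},\dots,x_N^{\sigma_N(j)})\le\sum_{j=1}^n c(x_1^j,\dots,x_N^j)$ for all $x^1,\dots,x^n\in\Gamma'$ and all permutations $\sigma_1,\dots,\sigma_N\in S_n$; $c$-monotone if it is $2$-$c$-monotone; and $c$-cyclically monotone if it is $n$-$c$-monotone for all $n\ge2$. Such a set is called maximal if it has no proper extension with the same property. If (i)–(v) hold, then: (A) $\Gamma$ is maximally $c$-monotone and maximally $c$-cyclically monotone. (B) $(f_1,\dots,f_N)$ is a $c$-conjugate $c$-splitting tuple of $\Gamma$. Here a tuple of functions $h_i:H\to(-\infty,+\infty]$ is a $c$-splitting tuple of $\Gamma$ if $c(x)\le\sum_i h_i(x_i)$ on $X$ with equality on $\Gamma$, and it is $c$-conjugate if the $h_i$ are proper and, for each $i_0$, $h_{i_0}(x_{i_0})=\sup\{c(x_1,\dots,x_N)-\sum_{i\ne i_0}h_i(x_i) : x_i\in H,\ i\neq i_0\}$ for all $x_{i_0}\in H$. Moreover, $(h_1,\dots,h_N)$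 is a $c$-conjugate $c$-splitting tuple of $\Gamma$ if and only if there are $\rho_1,\dots,\rho_N\in\mathbb R$ with $\sum_{i=1}^N\rho_i=0$ and $h_i=f_i+\rho_i$ for every $i$. -/

import Mathlib

open scoped InnerProductSpace

namespace MultiMarginal

noncomputable section

/-! Functions with values in `]-∞, +∞]` are represented as `EReal`-valued functions that never take
the value `⊥`. -/

/-! ### Splitting sets, `c`-conjugacy and `c`-monotonicity for a cost `c` on `X × ⋯ × X` -/

section Cost

variable {ι X : Type*} [Fintype ι]

/-- A function with values in `]-∞, +∞]` that is finite at some point. -/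
def IsProper (f : X → EReal) : Prop :=
  (∀ x, f x ≠ ⊥) ∧ ∃ x, f x ≠ ⊤

/-- `u` is a `c`-splitting tuple of `Γ`: the `u i` are `]-∞, +∞]`-valued, `c ≤ ⨁ u i` everywhere,
and equality holds on `Γ`. -/
def IsSplittingTuple (c : (ι → X) → ℝ) (Γ : Set (ι → X)) (u : ι → X → EReal) : Prop :=
  (∀ i x, u i x ≠ ⊥) ∧
  (∀ x : ι → X, (c x : EReal) ≤ ∑ i, u i (x i)) ∧
  ∀ x ∈ Γ, (c x : EReal) = ∑ i, u i (x i)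

/-- `Γ` is the `c`-splitting set generated by the tuple `u`: the `u i` are `]-∞, +∞]`-valued,
`c ≤ ⨁ u i` everywhere, and `Γ` is the set of all points of equality. -/
def IsSplittingSetGeneratedBy (c : (ι → X) → ℝ) (Γ : Set (ι → X)) (u : ι → X → EReal) : Prop :=
  (∀ i x, u i x ≠ ⊥) ∧
  (∀ x : ι → X, (c x : EReal) ≤ ∑ i, u i (x i)) ∧
  Γ = {x | (c x : EReal) = ∑ i, u i (x i)}

open Classical in
/-- `f` is a `c`-conjugate tuple: the `f i` are proper and each `f i₀` is the `c`-conjugate of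
`⨁_{i ≠ i₀} f i`, the supremum being over all points `z` of the product whose `i₀`-th coordinate
is the argument. -/
def IsConjugateTuple (c : (ι → X) → ℝ) (f : ι → X → EReal) : Prop :=
  (∀ i, IsProper (f i)) ∧
  ∀ (i₀ : ι) (x : X), f i₀ x =
    ⨆ (z : ι → X) (_ : z i₀ = x), (c z : EReal) - ∑ i ∈ Finset.univ.erase i₀, f i (z i)

/-- `Γ` is `c`-cyclically monotone of order `n` (`n`-`c`-monotone). -/
def IsNMonotone (c : (ι → X) → ℝ) (n : ℕ) (Γ : Set (ι → X)) : Prop :=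
  ∀ p : Fin n → ι → X, (∀ j, p j ∈ Γ) → ∀ σ : ι → Equiv.Perm (Fin n),
    ∑ j, c (fun i => p (σ i j) i) ≤ ∑ j, c (p j)

/-- `Γ` is `c`-cyclically monotone. -/
def IsCyclicallyMonotone (c : (ι → X) → ℝ) (Γ : Set (ι → X)) : Prop :=
  ∀ n : ℕ, 2 ≤ n → IsNMonotone c n Γ

/-- `Γ` is maximally `c`-monotone: it is `c`-monotone (of order `2`) and has no proper
`c`-monotone extension. -/
def IsMaximallyMonotoneSet (c : (ι → X) → ℝ) (Γ : Set (ι → X)) : Prop :=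
  IsNMonotone c 2 Γ ∧ ∀ Γ' : Set (ι → X), IsNMonotone c 2 Γ' → Γ ⊆ Γ' → Γ' = Γ

/-- `Γ` is maximally `c`-cyclically monotone. -/
def IsMaximallyCyclicallyMonotone (c : (ι → X) → ℝ) (Γ : Set (ι → X)) : Prop :=
  IsCyclicallyMonotone c Γ ∧
    ∀ Γ' : Set (ι → X), IsCyclicallyMonotone c Γ' → Γ ⊆ Γ' → Γ' = Γ

end Cost

/-! ### Convex analysis and set-valued mappings on a real Hilbert space -/

section Hilbert

variable {H : Type*} [NormedAddCommGroup H] [InnerProductSpace ℝ H]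

/-- Convexity of an extended-real-valued function: its epigraph is convex. -/
def IsConvex (f : H → EReal) : Prop :=
  Convex ℝ {p : H × ℝ | f p.1 ≤ (p.2 : EReal)}

/-- `q = ½‖·‖²`. -/
def q (x : H) : ℝ := ‖x‖ ^ 2 / 2

/-- The Fenchel conjugate `f^*`. -/
def conjugate (f : H → EReal) (u : H) : EReal :=
  ⨆ x : H, ((⟪u, x⟫_ℝ : ℝ) : EReal) - f x

/-- The Moreau envelope `e_f`. -/
def moreauEnvelope (f : H → EReal) (s : H) : EReal :=
  ⨅ x : H, f x + ((q (s - x) : ℝ) : EReal)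

/-- The proximity operator: `prox f x` is the minimizer of `y ↦ f y + q (y - x)` over `H`.
(For `f` proper, lower semicontinuous and convex on a Hilbert space this minimizer exists and is
unique.) -/
def prox (f : H → EReal) (x : H) : H :=
  Classical.epsilon fun y : H =>
    ∀ z : H, f y + ((q (y - x) : ℝ) : EReal) ≤ f z + ((q (z - x) : ℝ) : EReal)

/-- The subdifferential `∂f`, as a set-valued mapping. -/
def subdifferential (f : H → EReal) (x : H) : Set H :=
  {u | ∀ y : H, f x + ((⟪u, y - x⟫_ℝ : ℝ) : EReal) ≤ f y}

/-- Monotonicity of a set-valued mapping. -/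
def IsMonotoneMap (A : H → Set H) : Prop :=
  ∀ x y : H, ∀ u ∈ A x, ∀ v ∈ A y, 0 ≤ ⟪x - y, u - v⟫_ℝ

/-- Maximal monotonicity of a set-valued mapping: it is monotone and no monotone mapping has a
strictly larger graph. -/
def IsMaximallyMonotoneMap (A : H → Set H) : Prop :=
  IsMonotoneMap A ∧ ∀ B : H → Set H, IsMonotoneMap B → (∀ x, A x ⊆ B x) → B = A

variable {N : ℕ}

/-- The cost `c(x₁, …, x_N) = ∑_{i < j} ⟪x_i, x_j⟫`. -/
def cost (x : Fin N → H) : ℝ :=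
  ∑ i : Fin N, ∑ j ∈ Finset.Ioi i, ⟪x i, x j⟫_ℝ

/-- The set-valued mapping `A_i` associated with `Γ`; its graph is
`{(x_i, ∑_{j ≠ i} x_j) | x ∈ Γ}`. -/
def marginalMap (Γ : Set (Fin N → H)) (i : Fin N) (a : H) : Set H :=
  {b | ∃ x ∈ Γ, x i = a ∧ ∑ j ∈ Finset.univ.erase i, x j = b}

end Hilbert

end

end MultiMarginal

/-! Since `c(x) = q(∑ x_i) - ∑ q(x_i)` (`cost_eq_q_sum`), varying one coordinate of `x ∈ Γ` shows
`∑_{j ≠ i} x_j ∈ ∂f_i(x_i)`. So `A_i ⊆ ∂f_i` and `x_i = prox_{f_i}(s)` with `s = ∑ x_j`: a point of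
`Γ` is determined by its sum, and (i)–(v) all say that every `s ∈ H` is such a sum. If one `A_i`
equals `∂f_i`, every `s` is reached because `prox_{f_i}` is defined everywhere, which gives (iv).
Conversely, under (iv) both `∑ e_{f_i^*}` and `q` have subgradient `s` at each `s`, so they differ
by a constant, which is zero by looking at a point of `Γ`. Their difference at `s` is exactly the
defect `∑ f_i - c` at the tuple of proximal points (`sum_proxValue_eq`), hence that tuple lies in
`Γ`. For (A), a `2`-`c`-monotone extension has monotone marginal maps, which cannot exceed the
maximal `∂f_i`. For (B), `f_i` is a supremum of affine minorants, each realised by a point of `Γ`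
with one coordinate replaced. A point of `Γ` also supplies the affine minorant of `f_i` needed for
the existence of proximal points. -/

namespace MultiMarginal

/-! ### Extended reals -/

section Extended

variable {ι X : Type*}

lemma sum_ne_bot {s : Finset ι} {e : ι → EReal} (h : ∀ i ∈ s, e i ≠ ⊥) : ∑ i ∈ s, e i ≠ ⊥ := by
  classical
  induction s using Finset.induction_on with
  | empty => simp
  | insert a s ha ih =>
    rw [Finset.sum_insert ha, Ne, EReal.add_eq_bot_iff, not_or]
    exact ⟨h a (by simp), ih fun i hi => h i (by simp [hi])⟩

lemma ne_top_of_sum_ne_top {s : Finset ι} {e : ι → EReal} (h : ∀ i, e i ≠ ⊥)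
    (hs : ∑ i ∈ s, e i ≠ ⊤) {i : ι} (hi : i ∈ s) : e i ≠ ⊤ := by
  classical
  intro hT
  rw [← Finset.add_sum_erase s e hi, hT, EReal.top_add_of_ne_bot (sum_ne_bot fun j _ => h j)] at hs
  exact hs rfl

lemma coe_sum_real (s : Finset ι) (r : ι → ℝ) :
    ((∑ i ∈ s, r i : ℝ) : EReal) = ∑ i ∈ s, (r i : EReal) := by
  classical
  induction s using Finset.induction_on with
  | empty => simp
  | insert a s ha ih => rw [Finset.sum_insert ha, Finset.sum_insert ha, EReal.coe_add, ih]

lemma sum_eq_coe_sum_toReal {s : Finset ι} {e : ι → EReal} (hb : ∀ i ∈ s, e i ≠ ⊥)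
    (ht : ∀ i ∈ s, e i ≠ ⊤) : ∑ i ∈ s, e i = ((∑ i ∈ s, (e i).toReal : ℝ) : EReal) := by
  rw [coe_sum_real]
  exact Finset.sum_congr rfl fun i hi => (EReal.coe_toReal (ht i hi) (hb i hi)).symm

lemma iSup_add_coe {κ : Sort*} (u : κ → EReal) (r : ℝ) :
    (⨆ k, u k + (r : EReal)) = (⨆ k, u k) + (r : EReal) := by
  apply le_antisymm
  · exact iSup_le fun k => add_le_add_left (le_iSup u k) _
  · rw [← EReal.le_sub_iff_add_le (Or.inl (EReal.coe_ne_bot r)) (Or.inl (EReal.coe_ne_top r))]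
    refine iSup_le fun k => ?_
    rw [EReal.le_sub_iff_add_le (Or.inl (EReal.coe_ne_bot r)) (Or.inl (EReal.coe_ne_top r))]
    exact le_iSup (fun k => u k + (r : EReal)) k

lemma IsProper.toReal_le {f : X → EReal} (hf : IsProper f) {x : X} {r : ℝ} (h : f x ≤ r) :
    (f x).toReal ≤ r := by
  simpa using EReal.toReal_le_toReal h (hf.1 x) (EReal.coe_ne_top r)

end Extended

/-! ### Subgradients and proximal points -/

section Subgradient

variable {H : Type*} [NormedAddCommGroup H]

lemma q_nonneg (x : H) : 0 ≤ q x := by unfold q; positivity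

lemma q_eq_zero {x : H} (h : q x ≤ 0) : x = 0 := by
  have : ‖x‖ ^ 2 = 0 := le_antisymm (by unfold q at h; linarith) (by positivity)
  simpa using this

lemma continuous_q : Continuous (q : H → ℝ) := by unfold q; fun_prop

variable [InnerProductSpace ℝ H]

lemma q_eq_inner (x : H) : q x = ⟪x, x⟫_ℝ / 2 := by
  rw [q, real_inner_self_eq_norm_sq]

lemma q_add (x y : H) : q (x + y) = q x + q y + ⟪x, y⟫_ℝ := by
  simp only [q_eq_inner, inner_add_left, inner_add_right, real_inner_comm x y]; ring

lemma q_sub (x y : H) : q (x - y) = q x + q y - ⟪x, y⟫_ℝ := by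
  simp only [q_eq_inner, inner_sub_left, inner_sub_right, real_inner_comm x y]; ring

lemma q_smul (t : ℝ) (x : H) : q (t • x) = t ^ 2 * q x := by
  simp only [q_eq_inner, inner_smul_left, inner_smul_right, RCLike.conj_to_real]; ring

lemma IsConvex.combo_le {f : H → EReal} (hf : IsConvex f) {x y : H} {a b t : ℝ}
    (hx : f x ≤ a) (hy : f y ≤ b) (h0 : 0 ≤ t) (h1 : t ≤ 1) :
    f (x + t • (y - x)) ≤ ((a + t * (b - a) : ℝ) : EReal) := by
  have := hf (x := (x, a)) hx (y := (y, b)) hy (sub_nonneg.2 h1) h0 (by ring)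
  simp only [Set.mem_ofPred_eq, Prod.smul_mk, Prod.mk_add_mk, smul_eq_mul] at this
  have e1 : x + t • (y - x) = (1 - t) • x + t • y := by module
  have e2 : a + t * (b - a) = (1 - t) * a + t * b := by ring
  rwa [e1, e2]

lemma ne_top_of_mem_subdifferential {f : H → EReal} (hf : IsProper f) {p w : H}
    (h : w ∈ subdifferential f p) : f p ≠ ⊤ := by
  obtain ⟨y, hy⟩ := hf.2
  intro hT
  have := h y
  rw [hT, EReal.top_add_coe, top_le_iff] at this
  exact hy this

lemma mem_subdifferential_iff {f : H → EReal} (hf : IsProper f) {p w : H} (hp : f p ≠ ⊤) :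
    w ∈ subdifferential f p ↔
      ∀ (y : H) (r : ℝ), f y ≤ r → (f p).toReal + ⟪w, y - p⟫_ℝ ≤ r := by
  have hc := EReal.coe_toReal hp (hf.1 p)
  constructor
  · intro h y r hr
    have := (h y).trans hr
    rw [← hc] at this
    exact_mod_cast this
  · intro h y
    by_cases hy : f y = ⊤
    · rw [hy]; exact le_top
    · have := h y _ (EReal.le_coe_toReal hy)
      rw [← hc, ← EReal.coe_toReal hy (hf.1 y)]
      exact_mod_cast this

lemma subgradient_le {f : H → EReal} (hf : IsProper f) {p w y : H}
    (h : w ∈ subdifferential f p) (hy : f y ≠ ⊤) :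
    (f p).toReal + ⟪w, y - p⟫_ℝ ≤ (f y).toReal :=
  (mem_subdifferential_iff hf (ne_top_of_mem_subdifferential hf h)).1 h y _
    (EReal.le_coe_toReal hy)

lemma isMonotoneMap_subdifferential {f : H → EReal} (hf : IsProper f) :
    IsMonotoneMap (subdifferential f) := by
  intro x y u hu v hv
  have h1 := subgradient_le hf hu (ne_top_of_mem_subdifferential hf hv)
  have h2 := subgradient_le hf hv (ne_top_of_mem_subdifferential hf hu)
  rw [real_inner_comm]
  simp only [inner_sub_left, inner_sub_right] at *
  linarith

/-- The resolvent of a monotone mapping is single-valued. -/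
lemma IsMonotoneMap.resolvent_unique {A : H → Set H} (hA : IsMonotoneMap A) {x y s : H}
    (hx : s - x ∈ A x) (hy : s - y ∈ A y) : x = y := by
  have h := hA x y _ hx _ hy
  have e : s - x - (s - y) = -(x - y) := by abel
  rw [e, inner_neg_right] at h
  exact sub_eq_zero.1 (q_eq_zero (by rw [q_eq_inner]; linarith))

/-- Minty's criterion, the easy direction: a monotone mapping whose resolvent is everywhere defined
is maximally monotone. -/
lemma IsMonotoneMap.isMaximallyMonotoneMap {A : H → Set H} (hA : IsMonotoneMap A)
    (hsurj : ∀ s, ∃ p, s - p ∈ A p) : IsMaximallyMonotoneMap A := by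
  refine ⟨hA, fun B hB hAB => funext fun x => (Set.Subset.antisymm ?_ (hAB x))⟩
  intro u hu
  obtain ⟨p, hp⟩ := hsurj (x + u)
  have hxp : x = p := hB.resolvent_unique (s := x + u) (by simpa using hu) (hAB p hp)
  subst hxp
  simpa using hp

lemma subgradient_add_q_le {f : H → EReal} {p s : H} (h : s - p ∈ subdifferential f p) (z : H) :
    f p + ((q (p - s) : ℝ) : EReal) ≤ f z + ((q (z - s) : ℝ) : EReal) := by
  have e : q (p - s) ≤ ⟪s - p, z - p⟫_ℝ + q (z - s) := by
    have h1 := q_nonneg (z - p)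
    have h2 : z - s = (z - p) - (s - p) := by abel
    rw [h2, q_sub (z - p), real_inner_comm, ← neg_sub s p]
    have : q (-(s - p)) = q (s - p) := by rw [q, norm_neg, q]
    linarith
  calc f p + ((q (p - s) : ℝ) : EReal)
      ≤ f p + ((⟪s - p, z - p⟫_ℝ + q (z - s) : ℝ) : EReal) :=
        add_le_add_right (EReal.coe_le_coe_iff.2 e) _
    _ = f p + ((⟪s - p, z - p⟫_ℝ : ℝ) : EReal) + ((q (z - s) : ℝ) : EReal) := by
        rw [EReal.coe_add, add_assoc]
    _ ≤ _ := add_le_add_left (h z) _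

/-- First-order optimality for `f + μ q (· - s)`. -/
lemma IsConvex.mem_subdifferential_of_minimizer {f : H → EReal} (hf : IsProper f)
    (hc : IsConvex f) {p s : H} {μ : ℝ} (hp : f p ≠ ⊤)
    (h : ∀ (y : H) (r : ℝ), f y ≤ r → (f p).toReal + μ * q (p - s) ≤ r + μ * q (y - s)) :
    μ • (s - p) ∈ subdifferential f p := by
  rw [mem_subdifferential_iff hf hp]
  intro y r hr
  -- Minimality along the segment from `p` to `y`, divided by `t`; then `t → 0`.
  have key : ∀ t : ℝ, 0 < t → t ≤ 1 →
      (f p).toReal + ⟪μ • (s - p), y - p⟫_ℝ - r ≤ t * (μ * q (y - p)) := by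
    intro t h0 h1
    have h2 := h _ _ (hc.combo_le (EReal.le_coe_toReal hp) hr h0.le h1)
    have e : p + t • (y - p) - s = (p - s) + t • (y - p) := by abel
    rw [e, q_add, q_smul, inner_smul_right] at h2
    rw [inner_smul_left, RCLike.conj_to_real, ← neg_sub p s, inner_neg_left]
    have : t * ((f p).toReal + μ * -⟪p - s, y - p⟫_ℝ - r) ≤ t * (t * (μ * q (y - p))) := by
      linarith
    exact le_of_mul_le_mul_left this h0
  by_contra hlt
  push Not at hlt
  have hlim : Filter.Tendsto (fun t : ℝ => t * (μ * q (y - p))) (nhdsWithin 0 (Set.Ioi 0))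
      (nhds 0) := by
    have : Filter.Tendsto (fun t : ℝ => t * (μ * q (y - p))) (nhds 0) (nhds (0 * (μ * q (y - p)))) :=
      Filter.Tendsto.mul_const _ Filter.tendsto_id
    rw [zero_mul] at this
    exact this.mono_left nhdsWithin_le_nhds
  have := ge_of_tendsto hlim (b := (f p).toReal + ⟪μ • (s - p), y - p⟫_ℝ - r) (by
    filter_upwards [Ioc_mem_nhdsGT (zero_lt_one (α := ℝ))] with t ht using key t ht.1 ht.2)
  linarith

/-- Existence of proximal points for a convex lower semicontinuous function with an affine
minorant. -/
lemma IsConvex.exists_prox [CompleteSpace H] {f : H → EReal} (hf : IsProper f) (hc : IsConvex f)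
    (hl : LowerSemicontinuous f) {b : ℝ} {v : H}
    (hmin : ∀ (y : H) (r : ℝ), f y ≤ r → b + ⟪v, y⟫_ℝ ≤ r) {μ : ℝ} (hμ : 0 < μ) (s : H) :
    ∃ p, μ • (s - p) ∈ subdifferential f p := by
  set S : Set ℝ := {r | ∃ y : H, f y ≤ ((r - μ * q (y - s) : ℝ) : EReal)} with hS
  have hSne : S.Nonempty := by
    obtain ⟨y, hy⟩ := hf.2
    exact ⟨(f y).toReal + μ * q (y - s), y, by simpa using EReal.le_coe_toReal hy⟩
  have hSbdd : BddBelow S := by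
    -- The minimum of the affine minorant plus `μ q (· - s)`, found by completing the square.
    refine ⟨b + ⟪v, s⟫_ℝ - q v / μ, ?_⟩
    rintro r ⟨y, hy⟩
    have h1 := hmin y _ hy
    have h2 := q_nonneg (v + μ • (y - s))
    rw [q_add, q_smul, inner_smul_right, inner_sub_right] at h2
    have h3 : 0 ≤ (q v + μ ^ 2 * q (y - s) + μ * (⟪v, y⟫_ℝ - ⟪v, s⟫_ℝ)) / μ := by positivity
    have h4 : (q v + μ ^ 2 * q (y - s) + μ * (⟪v, y⟫_ℝ - ⟪v, s⟫_ℝ)) / μ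
        = q v / μ + μ * q (y - s) + (⟪v, y⟫_ℝ - ⟪v, s⟫_ℝ) := by field_simp
    linarith
  set m := sInf S with hm
  have hmle : ∀ (y : H) (r : ℝ), f y ≤ r → m ≤ r + μ * q (y - s) := fun y r hr =>
    csInf_le hSbdd ⟨y, by simpa using hr⟩
  let C : ℕ → Set H := fun n => {y | f y ≤ ((m + 1 / ((n : ℝ) + 1) - μ * q (y - s) : ℝ) : EReal)}
  have hCclosed : ∀ n, IsClosed (C n) := by
    intro n
    have hcont : Continuous fun y : H =>
        (y, ((m + 1 / ((n : ℝ) + 1) - μ * q (y - s) : ℝ) : EReal)) := by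
      refine continuous_id.prodMk (continuous_coe_real_ereal.comp ?_)
      have := continuous_q (H := H)
      fun_prop
    exact hl.isClosed_epigraph.preimage hcont
  -- Strong convexity: the midpoint of `y` and `z` gains `μ q (z - y) / 4`, yet its value is at
  -- least `m`. Cantor's intersection theorem then yields the minimizer.
  have hCdist : ∀ n, ∀ y ∈ C n, ∀ z ∈ C n, dist y z ≤ √(8 / μ * (1 / ((n : ℝ) + 1))) := by
    intro n y hy z hz
    have h1 := hmle _ _ (hc.combo_le hy hz (t := 1 / 2) (by norm_num) (by norm_num))
    have e1 : y + (1 / 2 : ℝ) • (z - y) - s = (y - s) + (1 / 2 : ℝ) • (z - y) := by abel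
    have e2 : q (z - s) = q (y - s) + q (z - y) + ⟪y - s, z - y⟫_ℝ := by
      rw [← q_add]; congr 1; abel
    rw [e1, q_add, q_smul, inner_smul_right, e2] at h1
    have h2 : μ * q (z - y) ≤ 4 * (1 / ((n : ℝ) + 1)) := by linarith
    rw [dist_comm, dist_eq_norm]
    apply Real.le_sqrt_of_sq_le
    have h3 : ‖z - y‖ ^ 2 = 2 / μ * (μ * q (z - y)) := by unfold q; field_simp
    rw [h3]
    calc 2 / μ * (μ * q (z - y)) ≤ 2 / μ * (4 * (1 / ((n : ℝ) + 1))) := by gcongr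
      _ = _ := by ring
  have hCne : ∀ n, (C n).Nonempty := by
    intro n
    obtain ⟨r, ⟨y, hy⟩, hr⟩ := exists_lt_of_csInf_lt hSne
      (show sInf S < m + 1 / ((n : ℝ) + 1) by have : 0 < 1 / ((n : ℝ) + 1) := by positivity
                                              linarith)
    exact ⟨y, hy.trans (EReal.coe_le_coe_iff.2 (by linarith))⟩
  have hCanti : ∀ n k, k ≤ n → C n ⊆ C k := by
    intro n k hk y hy
    refine le_trans (show f y ≤ _ from hy) (EReal.coe_le_coe_iff.2 ?_)
    have : 1 / ((n : ℝ) + 1) ≤ 1 / ((k : ℝ) + 1) := by gcongr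
    linarith
  have hbdd : ∀ n, Bornology.IsBounded (C n) := fun n =>
    Metric.isBounded_iff.2 ⟨_, fun y hy z hz => hCdist n y hy z hz⟩
  have hlim : Filter.Tendsto (fun n => Metric.diam (C n)) Filter.atTop (nhds 0) := by
    have h1 : Filter.Tendsto (fun n : ℕ => √(8 / μ * (1 / ((n : ℝ) + 1)))) Filter.atTop
        (nhds 0) := by
      have := ((tendsto_one_div_add_atTop_nhds_zero_nat (𝕜 := ℝ)).const_mul (8 / μ)).sqrt
      simpa using this
    exact squeeze_zero (fun _ => Metric.diam_nonneg)
      (fun n => Metric.diam_le_of_forall_dist_le (Real.sqrt_nonneg _) (hCdist n)) h1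
  obtain ⟨p, hp⟩ := Metric.nonempty_iInter_of_nonempty_biInter hCclosed hbdd (fun n =>
    (hCne n).mono (Set.subset_iInter₂ fun k hk => hCanti n k hk)) hlim
  rw [Set.mem_iInter] at hp
  have hpT : f p ≠ ⊤ := ne_top_of_le_ne_top (EReal.coe_ne_top _) (show f p ≤ _ from hp 0)
  have hpm : (f p).toReal + μ * q (p - s) ≤ m := by
    have h1 : ∀ n : ℕ, (f p).toReal + μ * q (p - s) - m ≤ 1 / ((n : ℝ) + 1) := fun n => by
      have := hf.toReal_le (hp n)
      linarith
    have := ge_of_tendsto' (tendsto_one_div_add_atTop_nhds_zero_nat (𝕜 := ℝ)) h1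
    linarith
  exact ⟨p, hc.mem_subdifferential_of_minimizer hf hpT fun y r hr => hpm.trans (hmle y r hr)⟩

lemma minorant_of_mem_subdifferential {f : H → EReal} (hf : IsProper f) {p v : H}
    (h : v ∈ subdifferential f p) (y : H) (r : ℝ) (hr : f y ≤ r) :
    ((f p).toReal - ⟪v, p⟫_ℝ) + ⟪v, y⟫_ℝ ≤ r := by
  have := (mem_subdifferential_iff hf (ne_top_of_mem_subdifferential hf h)).1 h y r hr
  rw [inner_sub_right] at this
  linarith

lemma sub_prox_mem_subdifferential [CompleteSpace H] {f : H → EReal} (hf : IsProper f)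
    (hc : IsConvex f) (hl : LowerSemicontinuous f) {p₀ v : H} (h₀ : v ∈ subdifferential f p₀)
    (s : H) : s - prox f s ∈ subdifferential f (prox f s) := by
  obtain ⟨p, hp⟩ := hc.exists_prox hf hl (minorant_of_mem_subdifferential hf h₀) one_pos s
  rw [one_smul] at hp
  have hmin : ∀ z, f (prox f s) + ((q (prox f s - s) : ℝ) : EReal) ≤
      f z + ((q (z - s) : ℝ) : EReal) :=
    Classical.epsilon_spec (p := fun y : H =>
      ∀ z : H, f y + ((q (y - s) : ℝ) : EReal) ≤ f z + ((q (z - s) : ℝ) : EReal))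
      ⟨p, subgradient_add_q_le hp⟩
  have hT : f (prox f s) ≠ ⊤ := by
    intro hT
    have := hmin p
    rw [hT, EReal.top_add_coe, top_le_iff] at this
    exact (EReal.add_lt_top (ne_top_of_mem_subdifferential hf hp) (EReal.coe_ne_top _)).ne this
  have := hc.mem_subdifferential_of_minimizer hf (s := s) (μ := 1) hT (fun y r hr => by
    have h1 := (hmin y).trans (add_le_add_left hr _)
    rw [← EReal.coe_toReal hT (hf.1 _)] at h1
    rw [one_mul, one_mul]
    exact_mod_cast h1)
  rwa [one_smul] at this

/-- A convex lower semicontinuous function is the supremum of its affine minorants at points of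
subdifferentiability. -/
lemma IsConvex.exists_subgradient_ge [CompleteSpace H] {f : H → EReal} (hf : IsProper f)
    (hc : IsConvex f) (hl : LowerSemicontinuous f) {p₀ v : H} (h₀ : v ∈ subdifferential f p₀)
    {x : H} {a : ℝ} (ha : (a : EReal) < f x) :
    ∃ p w, w ∈ subdifferential f p ∧ a ≤ (f p).toReal + ⟪w, x - p⟫_ℝ := by
  have hmin := minorant_of_mem_subdifferential hf h₀
  obtain ⟨ε, hε, hball⟩ := Metric.eventually_nhds_iff.1 (hl x a ha)
  set β := |(f p₀).toReal - ⟪v, p₀⟫_ℝ + ⟪v, x⟫_ℝ - a| with hβ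
  -- Chosen so that `μ d ^ 2 ≥ ‖v‖ d + β` for `d ≥ ε`: a proximal point far from `x` is compensated
  -- by the quadratic term, a near one by lower semicontinuity.
  set μ := ‖v‖ / ε + β / ε ^ 2 + 1 with hμ
  have hμ0 : 0 < μ := by positivity
  obtain ⟨p, hp⟩ := hc.exists_prox hf hl hmin hμ0 x
  have hpT := ne_top_of_mem_subdifferential hf hp
  refine ⟨p, _, hp, ?_⟩
  rw [inner_smul_left, RCLike.conj_to_real, real_inner_self_eq_norm_sq]
  by_cases hd : dist p x < ε
  · have h1 : (a : EReal) < f p := hball hd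
    rw [← EReal.coe_toReal hpT (hf.1 p), EReal.coe_lt_coe_iff] at h1
    have : 0 ≤ μ * ‖x - p‖ ^ 2 := by positivity
    linarith
  · push Not at hd
    rw [dist_comm, dist_eq_norm] at hd
    have h1 := hmin p _ (EReal.le_coe_toReal hpT)
    have h2 : ⟪v, x - p⟫_ℝ ≤ ‖v‖ * ‖x - p‖ := real_inner_le_norm _ _
    rw [inner_sub_right] at h2
    have h3 : -β ≤ (f p₀).toReal - ⟪v, p₀⟫_ℝ + ⟪v, x⟫_ℝ - a := neg_abs_le _
    set d := ‖x - p‖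
    have h4 : 1 ≤ d / ε := (one_le_div hε).2 hd
    have hβ0 : 0 ≤ β := abs_nonneg _
    have h5 : ‖v‖ * d ≤ ‖v‖ / ε * d ^ 2 := by
      have : ‖v‖ / ε * d ^ 2 = ‖v‖ * d * (d / ε) := by ring
      rw [this]
      exact le_mul_of_one_le_right (by positivity) h4
    have h6 : β ≤ β / ε ^ 2 * d ^ 2 := by
      have : β / ε ^ 2 * d ^ 2 = β * (d / ε) ^ 2 := by ring
      rw [this]
      exact le_mul_of_one_le_right hβ0 (one_le_pow₀ h4)
    have h7 : μ * d ^ 2 = ‖v‖ / ε * d ^ 2 + β / ε ^ 2 * d ^ 2 + d ^ 2 := by rw [hμ]; ring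
    have : 0 ≤ d ^ 2 := by positivity
    linarith

/-- Two functions with a common nonexpansive selection of subgradients differ by a constant. -/
lemma sub_eq_sub_of_common_subgradient {φ ψ : H → ℝ} {P : H → H}
    (hP : ∀ s t, ⟪t - s, P t - P s⟫_ℝ ≤ ‖t - s‖ ^ 2)
    (hφ : ∀ s t, φ s + ⟪t - s, P s⟫_ℝ ≤ φ t) (hψ : ∀ s t, ψ s + ⟪t - s, P s⟫_ℝ ≤ ψ t) (s t : H) :
    φ s - ψ s = φ t - ψ t := by
  -- Both increments lie between `⟪t - s, P s⟫` and `⟪t - s, P t⟫`, so `φ - ψ` varies quadratically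
  -- and has zero derivative.
  have hbound : ∀ s t, ‖(φ t - ψ t) - (φ s - ψ s)‖ ≤ ‖t - s‖ ^ 2 := by
    intro s t
    have h1 := hφ s t
    have h2 := hφ t s
    have h3 := hψ s t
    have h4 := hψ t s
    have h5 := hP s t
    rw [← neg_sub t s, inner_neg_left] at h2 h4
    rw [inner_sub_right] at h5
    rw [Real.norm_eq_abs, abs_le]
    constructor <;> linarith
  have hderiv : ∀ x, HasFDerivAt (fun x => φ x - ψ x) (0 : H →L[ℝ] ℝ) x := by
    intro x
    refine HasFDerivAt.of_isLittleO ?_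
    have h1 : (fun y => (φ y - ψ y) - (φ x - ψ x) - (0 : H →L[ℝ] ℝ) (y - x))
        =O[nhds x] fun y => ‖y - x‖ ^ 2 :=
      Asymptotics.isBigO_of_le _ fun y => by simpa using hbound x y
    exact h1.trans_isLittleO (by
      have := Asymptotics.isLittleO_pow_sub_sub x (m := 2) one_lt_two
      simpa using this)
  exact is_const_of_fderiv_eq_zero (𝕜 := ℝ) (fun x => (hderiv x).differentiableAt)
    (fun x => (hderiv x).fderiv) s t

lemma norm_resolvent_bound {f : H → EReal} (hf : IsProper f) {P : H → H}
    (hP : ∀ s, s - P s ∈ subdifferential f (P s)) (s t : H) :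
    ⟪t - s, P t - P s⟫_ℝ ≤ ‖t - s‖ ^ 2 := by
  have h := isMonotoneMap_subdifferential hf _ _ _ (hP t) _ (hP s)
  have e : t - P t - (s - P s) = (t - s) - (P t - P s) := by abel
  rw [e] at h
  have h2 := q_nonneg ((t - s) - (P t - P s))
  have h3 := q_nonneg (t - s)
  rw [q_sub] at h2
  rw [inner_sub_right, real_inner_comm] at h
  rw [← real_inner_self_eq_norm_sq]
  rw [q_eq_inner, q_eq_inner] at h2
  rw [q_eq_inner] at h3
  linarith

/-- The value at `s` of the conjugate of `f + q`, where `p` is the proximal point of `s`. -/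
noncomputable def proxValue (f : H → EReal) (s p : H) : ℝ := ⟪s, p⟫_ℝ - (f p).toReal - q p

/-- The left side is `proxValue f t (P s)`, and `P t` maximizes `proxValue f t`. Thus `P s` is a
subgradient at `s` of `(f + q)^*`. -/
lemma proxValue_add_le {f : H → EReal} (hf : IsProper f) {P : H → H}
    (hP : ∀ s, s - P s ∈ subdifferential f (P s)) (s t : H) :
    proxValue f s (P s) + ⟪t - s, P s⟫_ℝ ≤ proxValue f t (P t) := by
  have h := subgradient_le hf (hP t) (ne_top_of_mem_subdifferential hf (hP s))
  have h2 := q_nonneg (P t - P s)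
  rw [q_sub] at h2
  have h3 : ⟪P t, P t⟫_ℝ = 2 * q (P t) := by rw [q_eq_inner]; ring
  simp only [proxValue, inner_sub_left, inner_sub_right] at *
  linarith

/-- Moreau decomposition: the infimum is attained at `s - p`, where Fenchel–Young is an equality. -/
lemma moreauEnvelope_conjugate_eq {f : H → EReal} (hf : IsProper f) {s p : H}
    (hp : s - p ∈ subdifferential f p) :
    moreauEnvelope (conjugate f) s = (proxValue f s p : EReal) := by
  have hT := ne_top_of_mem_subdifferential hf hp
  apply le_antisymm
  · refine (iInf_le _ (s - p)).trans ?_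
    have h1 : conjugate f (s - p) ≤ ((⟪s - p, p⟫_ℝ - (f p).toReal : ℝ) : EReal) := by
      refine iSup_le fun y => ?_
      by_cases hy : f y = ⊤
      · simp [hy]
      · have h2 := subgradient_le hf hp hy
        rw [inner_sub_right] at h2
        rw [← EReal.coe_toReal hy (hf.1 y), ← EReal.coe_sub, EReal.coe_le_coe_iff]
        linarith
    refine (add_le_add_left h1 _).trans ?_
    rw [← EReal.coe_add, EReal.coe_le_coe_iff, sub_sub_cancel, proxValue, inner_sub_left,
      q_eq_inner]
    linarith
  · refine le_iInf fun u => ?_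
    have h1 : ((⟪u, p⟫_ℝ - (f p).toReal : ℝ) : EReal) ≤ conjugate f u := by
      refine le_trans ?_ (le_iSup _ p)
      rw [EReal.coe_sub, EReal.coe_toReal hT (hf.1 p)]
    refine le_trans ?_ (add_le_add_left h1 _)
    rw [← EReal.coe_add, EReal.coe_le_coe_iff, proxValue]
    have h2 := q_nonneg ((s - u) - p)
    rw [q_sub, inner_sub_left] at h2
    linarith

end Subgradient

/-! ### Splitting tuples -/

section Splitting

variable {ι X : Type*} [Fintype ι] {c : (ι → X) → ℝ} {Γ : Set (ι → X)} {u : ι → X → EReal}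

lemma IsSplittingTuple.ne_top (hu : IsSplittingTuple c Γ u) {x : ι → X} (hx : x ∈ Γ) (i : ι) :
    u i (x i) ≠ ⊤ :=
  ne_top_of_sum_ne_top (fun j => hu.1 j (x j))
    (by rw [← hu.2.2 x hx]; exact EReal.coe_ne_top _) (Finset.mem_univ i)

lemma IsSplittingTuple.eq_sum (hu : IsSplittingTuple c Γ u) {x : ι → X} (hx : x ∈ Γ) :
    c x = ∑ i, (u i (x i)).toReal := by
  have := hu.2.2 x hx
  rw [sum_eq_coe_sum_toReal (fun i _ => hu.1 i (x i)) fun i _ => hu.ne_top hx i] at this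
  exact_mod_cast this

lemma IsSplittingTuple.le_sum (hu : IsSplittingTuple c Γ u) {x : ι → X}
    (hx : ∀ i, u i (x i) ≠ ⊤) : c x ≤ ∑ i, (u i (x i)).toReal := by
  have := hu.2.1 x
  rw [sum_eq_coe_sum_toReal (fun i _ => hu.1 i (x i)) fun i _ => hx i] at this
  exact_mod_cast this

lemma IsSplittingSetGeneratedBy.isSplittingTuple (hΓ : IsSplittingSetGeneratedBy c Γ u) :
    IsSplittingTuple c Γ u :=
  ⟨hΓ.1, hΓ.2.1, fun x hx => by rw [hΓ.2.2] at hx; exact hx⟩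

lemma IsSplittingSetGeneratedBy.mem_of_eq_sum (hΓ : IsSplittingSetGeneratedBy c Γ u) {x : ι → X}
    (hx : ∀ i, u i (x i) ≠ ⊤) (h : c x = ∑ i, (u i (x i)).toReal) : x ∈ Γ := by
  rw [hΓ.2.2]
  change (c x : EReal) = _
  rw [sum_eq_coe_sum_toReal (fun i _ => hΓ.1 i (x i)) fun i _ => hx i, h]

/-- Shuffling coordinates leaves the separable sum `∑ u i` unchanged; it dominates `c` everywhere
and equals it on `Γ`. -/
lemma IsSplittingTuple.isNMonotone (hu : IsSplittingTuple c Γ u) (n : ℕ) : IsNMonotone c n Γ := by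
  intro p hp σ
  calc ∑ j, c (fun i => p (σ i j) i)
      ≤ ∑ j, ∑ i, (u i (p (σ i j) i)).toReal :=
        Finset.sum_le_sum fun j _ => hu.le_sum fun i => hu.ne_top (hp _) i
    _ = ∑ i, ∑ j, (u i (p (σ i j) i)).toReal := Finset.sum_comm
    _ = ∑ i, ∑ j, (u i (p j i)).toReal := Finset.sum_congr rfl fun i _ =>
        Equiv.sum_comp (σ i) fun j => (u i (p j i)).toReal
    _ = ∑ j, ∑ i, (u i (p j i)).toReal := Finset.sum_comm
    _ = ∑ j, c (p j) := Finset.sum_congr rfl fun j _ => (hu.eq_sum (hp j)).symm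

/-- Each entry of a splitting tuple dominates the conjugate of the others. -/
lemma IsSplittingTuple.sub_sum_erase_le [DecidableEq ι] (hu : IsSplittingTuple c Γ u) (i : ι)
    (z : ι → X) : (c z : EReal) - ∑ j ∈ Finset.univ.erase i, u j (z j) ≤ u i (z i) := by
  apply EReal.sub_le_of_le_add
  rw [Finset.add_sum_erase _ (fun j => u j (z j)) (Finset.mem_univ i)]
  exact hu.2.1 z

end Splitting

/-! ### The cost -/

section Cost

variable {N : ℕ}

lemma sum_erase_update {H M : Type*} [AddCommMonoid M] (x : Fin N → H) (i : Fin N) (y : H)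
    (g : Fin N → H → M) : ∑ j ∈ Finset.univ.erase i, g j (Function.update x i y j) =
      ∑ j ∈ Finset.univ.erase i, g j (x j) :=
  Finset.sum_congr rfl fun j hj => by rw [Function.update_of_ne (Finset.ne_of_mem_erase hj)]

lemma sum_erase_eq_sub {H : Type*} [AddCommGroup H] (x : Fin N → H) (i : Fin N) :
    ∑ j ∈ Finset.univ.erase i, x j = ∑ j, x j - x i :=
  Finset.sum_erase_eq_sub (Finset.mem_univ i)

variable {H : Type*} [NormedAddCommGroup H] [InnerProductSpace ℝ H]

/-- Through this identity `c ≤ ∑ f_i` reads `q(∑ x_i) ≤ ∑ (f_i + q)(x_i)`. -/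
lemma cost_eq_q_sum (x : Fin N → H) : cost x = q (∑ i, x i) - ∑ i, q (x i) := by
  have h1 := Finset.sum_sum_Ioi_add_eq_sum_sum_off_diag fun i j => ⟪x i, x j⟫_ℝ
  have h2 : ∑ i, ∑ j ∈ Finset.Ioi i, (⟪x j, x i⟫_ℝ + ⟪x i, x j⟫_ℝ) = 2 * cost x := by
    rw [cost, Finset.mul_sum]
    refine Finset.sum_congr rfl fun i _ => ?_
    rw [Finset.mul_sum]
    refine Finset.sum_congr rfl fun j _ => ?_
    rw [real_inner_comm]; ring
  have h3 : ⟪∑ i, x i, ∑ i, x i⟫_ℝ =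
      ∑ i, ⟪x i, x i⟫_ℝ + ∑ i, ∑ j ∈ ({i}ᶜ : Finset (Fin N)), ⟪x j, x i⟫_ℝ := by
    rw [inner_sum, ← Finset.sum_add_distrib]
    refine Finset.sum_congr rfl fun i _ => ?_
    rw [sum_inner, Fintype.sum_eq_add_sum_compl i]
  have h4 : ∑ i, q (x i) = (∑ i, ⟪x i, x i⟫_ℝ) / 2 := by
    rw [Finset.sum_div]; exact Finset.sum_congr rfl fun i _ => q_eq_inner _
  rw [h4, q_eq_inner, h3, ← h1, h2]
  ring

lemma cost_eq_inner_add (x : Fin N → H) (i : Fin N) :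
    cost x = ⟪x i, ∑ j ∈ Finset.univ.erase i, x j⟫_ℝ +
      (q (∑ j ∈ Finset.univ.erase i, x j) - ∑ j ∈ Finset.univ.erase i, q (x j)) := by
  rw [cost_eq_q_sum, ← Finset.add_sum_erase _ x (Finset.mem_univ i),
    ← Finset.add_sum_erase _ (fun j => q (x j)) (Finset.mem_univ i), q_add]
  ring

lemma cost_update (x : Fin N → H) (i : Fin N) (y : H) :
    cost (Function.update x i y) =
      cost x + ⟪y - x i, ∑ j ∈ Finset.univ.erase i, x j⟫_ℝ := by
  rw [cost_eq_inner_add _ i, cost_eq_inner_add x i, sum_erase_update x i y fun _ z => z,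
    sum_erase_update x i y fun _ => q, Function.update_self, inner_sub_left]
  ring

/-- Exchanging one coordinate between two points of a `2`-`c`-monotone set. -/
lemma IsNMonotone.isMonotoneMap_marginalMap {Γ : Set (Fin N → H)} (hΓ : IsNMonotone cost 2 Γ)
    (i : Fin N) : IsMonotoneMap (marginalMap Γ i) := by
  rintro a b u ⟨x, hx, rfl, rfl⟩ v ⟨y, hy, rfl, rfl⟩
  have h := hΓ ![x, y] (by simp [Fin.forall_fin_two, hx, hy])
    (fun k => if k = i then Equiv.swap 0 1 else 1)
  have e0 : (fun k => (![x, y] : Fin 2 → Fin N → H)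
      ((if k = i then Equiv.swap 0 1 else 1 : Equiv.Perm (Fin 2)) 0) k) =
      Function.update x i (y i) := by
    funext k
    by_cases hk : k = i
    · subst hk; simp
    · simp [hk]
  have e1 : (fun k => (![x, y] : Fin 2 → Fin N → H)
      ((if k = i then Equiv.swap 0 1 else 1 : Equiv.Perm (Fin 2)) 1) k) =
      Function.update y i (x i) := by
    funext k
    by_cases hk : k = i
    · subst hk; simp
    · simp [hk]
  rw [Fin.sum_univ_two, Fin.sum_univ_two, e0, e1, cost_update, cost_update] at h
  simp only [Matrix.cons_val_zero, Matrix.cons_val_one] at h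
  simp only [inner_sub_left, inner_sub_right] at h ⊢
  linarith

variable {Γ : Set (Fin N → H)} {f : Fin N → H → EReal}

/-- The cost is affine in the `i`-th coordinate with slope `∑_{j ≠ i} x_j`, and touches the
splitting bound at `x`. -/
lemma IsSplittingTuple.sum_erase_mem_subdifferential (hf : IsSplittingTuple cost Γ f)
    (hproper : ∀ i, IsProper (f i)) {x : Fin N → H} (hx : x ∈ Γ) (i : Fin N) :
    ∑ j ∈ Finset.univ.erase i, x j ∈ subdifferential (f i) (x i) := by
  rw [mem_subdifferential_iff (hproper i) (hf.ne_top hx i)]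
  intro y r hr
  have hy : f i y ≠ ⊤ := ne_top_of_le_ne_top (EReal.coe_ne_top r) hr
  have h1 := hf.le_sum (x := Function.update x i y) (fun j => by
    by_cases hj : j = i
    · subst hj; simpa using hy
    · rw [Function.update_of_ne hj]; exact hf.ne_top hx j)
  have h2 := hf.eq_sum hx
  have h3 := (hproper i).toReal_le hr
  rw [cost_update, ← Finset.add_sum_erase _ _ (Finset.mem_univ i),
    sum_erase_update x i y fun j z => (f j z).toReal, Function.update_self, real_inner_comm] at h1
  rw [← Finset.add_sum_erase _ _ (Finset.mem_univ i)] at h2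
  linarith

lemma IsSplittingTuple.marginalMap_subset (hf : IsSplittingTuple cost Γ f)
    (hproper : ∀ i, IsProper (f i)) (i : Fin N) (a : H) :
    marginalMap Γ i a ⊆ subdifferential (f i) a := by
  rintro _ ⟨x, hx, rfl, rfl⟩
  exact hf.sum_erase_mem_subdifferential hproper hx i

lemma sum_proxValue_eq {p : Fin N → H} {s : H} (hs : ∑ i, p i = s) :
    ∑ i, proxValue (f i) s (p i) = q s + (cost p - ∑ i, (f i (p i)).toReal) := by
  have h : ∑ i, ⟪s, p i⟫_ℝ = 2 * q s := by rw [← inner_sum, hs, q_eq_inner]; ring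
  simp only [proxValue, Finset.sum_sub_distrib]
  rw [h, cost_eq_q_sum, hs]
  ring

/-- The sum of the Moreau envelopes of the conjugates is `q` when the proximal points sum to the
identity. -/
lemma IsSplittingTuple.sum_proxValue_eq_q (hf : IsSplittingTuple cost Γ f)
    (hproper : ∀ i, IsProper (f i)) (hne : Γ.Nonempty) {P : Fin N → H → H}
    (hP : ∀ i s, s - P i s ∈ subdifferential (f i) (P i s)) (hsum : ∀ s, ∑ i, P i s = s) (s : H) :
    ∑ i, proxValue (f i) s (P i s) = q s := by
  obtain ⟨x, hx⟩ := hne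
  -- A point of `Γ` is the proximal tuple of its own sum; there the constant is seen to vanish.
  set t := ∑ i, x i with ht
  have hxP : ∀ i, x i = P i t := fun i =>
    (isMonotoneMap_subdifferential (hproper i)).resolvent_unique (s := t)
      (by rw [ht, ← sum_erase_eq_sub]; exact hf.sum_erase_mem_subdifferential hproper hx i)
      (hP i t)
  have hφ : ∀ s t, ∑ i, proxValue (f i) s (P i s) + ⟪t - s, s⟫_ℝ ≤
      ∑ i, proxValue (f i) t (P i t) := by
    intro s t
    have e : ⟪t - s, s⟫_ℝ = ∑ i, ⟪t - s, P i s⟫_ℝ := by rw [← inner_sum, hsum]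
    rw [e, ← Finset.sum_add_distrib]
    exact Finset.sum_le_sum fun i _ => proxValue_add_le (hproper i) (hP i) s t
  have hψ : ∀ s t : H, q s + ⟪t - s, s⟫_ℝ ≤ q t := by
    intro s t
    have h := q_nonneg (t - s)
    rw [q_sub] at h
    have h' : ⟪s, s⟫_ℝ = 2 * q s := by rw [q_eq_inner]; ring
    rw [inner_sub_left]
    linarith
  have h := sub_eq_sub_of_common_subgradient (P := fun s => s)
    (fun s t => (real_inner_self_eq_norm_sq _).le) hφ hψ s t
  have h2 : ∑ i, proxValue (f i) t (P i t) = q t := by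
    simp only [← hxP]
    rw [sum_proxValue_eq ht.symm, hf.eq_sum hx, sub_self, add_zero]
  linarith

/-- `∑ P i s` is a subgradient of `q` at `s`, and `s` is the only one; the discrepancy `w` itself is
the test direction. -/
lemma sum_eq_of_sum_proxValue_eq_q (hproper : ∀ i, IsProper (f i)) {P : Fin N → H → H}
    (hP : ∀ i s, s - P i s ∈ subdifferential (f i) (P i s))
    (h : ∀ s, ∑ i, proxValue (f i) s (P i s) = q s) (s : H) : ∑ i, P i s = s := by
  set w := ∑ i, P i s - s with hw
  have h1 : q s + ⟪w, ∑ i, P i s⟫_ℝ ≤ q (s + w) := by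
    rw [← h, ← h, inner_sum, ← Finset.sum_add_distrib]
    refine Finset.sum_le_sum fun i _ => ?_
    have := proxValue_add_le (hproper i) (hP i) s (s + w)
    rwa [add_sub_cancel_left] at this
  have e : ∑ i, P i s = s + w := by rw [hw]; abel
  rw [e, inner_add_right, q_add, real_inner_comm] at h1
  have h2 : ⟪w, w⟫_ℝ = 2 * q w := by rw [q_eq_inner]; ring
  rw [e, q_eq_zero (x := w) (by linarith), add_zero]

/-- Points of the splitting set are recovered from proximal points. -/
lemma IsSplittingSetGeneratedBy.prox_mem (hΓ : IsSplittingSetGeneratedBy cost Γ f)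
    (hproper : ∀ i, IsProper (f i)) (hne : Γ.Nonempty) {P : Fin N → H → H}
    (hP : ∀ i s, s - P i s ∈ subdifferential (f i) (P i s)) (hsum : ∀ s, ∑ i, P i s = s) (s : H) :
    (fun i => P i s) ∈ Γ := by
  have h1 := hΓ.isSplittingTuple.sum_proxValue_eq_q hproper hne hP hsum s
  rw [sum_proxValue_eq (hsum s)] at h1
  exact hΓ.mem_of_eq_sum (fun i => ne_top_of_mem_subdifferential (hproper i) (hP i s))
    (by linarith)

/-- If the mappings `A_i` are maximally monotone then `Γ` is maximally `2`-`c`-monotone. -/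
lemma IsSplittingTuple.isMaximallyMonotoneSet (hf : IsSplittingTuple cost Γ f)
    (hproper : ∀ i, IsProper (f i)) {P : Fin N → H → H}
    (hP : ∀ i s, s - P i s ∈ subdifferential (f i) (P i s)) (hmem : ∀ s, (fun i => P i s) ∈ Γ)
    (hmax : ∀ i, IsMaximallyMonotoneMap (marginalMap Γ i)) : IsMaximallyMonotoneSet cost Γ := by
  refine ⟨hf.isNMonotone 2, fun Γ' hΓ' hsub => (Set.Subset.antisymm ?_ hsub)⟩
  intro y hy
  -- Maximality absorbs the marginal maps of `Γ'`, so each `y i` is the resolvent of the same point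
  -- `∑ j, y j`.
  have heq : y = fun i => P i (∑ j, y j) := by
    funext i
    have h1 : marginalMap Γ' i = marginalMap Γ i :=
      (hmax i).2 _ (hΓ'.isMonotoneMap_marginalMap i)
        fun a _ ⟨x, hx, hxa, hxb⟩ => ⟨x, hsub hx, hxa, hxb⟩
    have h2 : ∑ j, y j - y i ∈ marginalMap Γ' i (y i) := ⟨y, hy, rfl, sum_erase_eq_sub y i⟩
    rw [h1] at h2
    exact (isMonotoneMap_subdifferential (hproper i)).resolvent_unique
      (hf.marginalMap_subset hproper i _ h2) (hP i _)
  rw [heq]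
  exact hmem _

lemma IsMaximallyMonotoneSet.isMaximallyCyclicallyMonotone (hf : IsSplittingTuple cost Γ f)
    (h : IsMaximallyMonotoneSet cost Γ) : IsMaximallyCyclicallyMonotone cost Γ :=
  ⟨fun n _ => hf.isNMonotone n, fun Γ' hΓ' hsub => h.2 Γ' (hΓ' 2 le_rfl) hsub⟩

/-- A splitting tuple of convex lower semicontinuous functions whose subdifferentials are given by
the splitting set is conjugate. -/
lemma IsSplittingTuple.isConjugateTuple [CompleteSpace H] (hne : Γ.Nonempty)
    (hf : IsSplittingTuple cost Γ f) (hproper : ∀ i, IsProper (f i))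
    (hconvex : ∀ i, IsConvex (f i)) (hlsc : ∀ i, LowerSemicontinuous (f i))
    (hsub : ∀ i a, subdifferential (f i) a ⊆ marginalMap Γ i a) : IsConjugateTuple cost f := by
  classical
  refine ⟨hproper, fun i x => le_antisymm ?_ ?_⟩
  · refine EReal.ge_of_forall_gt_iff_ge.1 fun a ha => ?_
    obtain ⟨x₀, hx₀⟩ := hne
    obtain ⟨p, w, hw, haw⟩ := (hconvex i).exists_subgradient_ge (hproper i) (hlsc i)
      (hf.sum_erase_mem_subdifferential hproper hx₀ i) ha
    obtain ⟨z, hz, rfl, rfl⟩ := hsub i p hw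
    -- Replacing the `i`-th coordinate of `z ∈ Γ` by `x` gives a competitor whose value is the
    -- affine minorant evaluated at `x`.
    refine le_trans ?_ (le_iSup₂ (Function.update z i x) (Function.update_self ..))
    have h1 : ∑ j ∈ Finset.univ.erase i, f j (Function.update z i x j) =
        ((∑ j ∈ Finset.univ.erase i, (f j (z j)).toReal : ℝ) : EReal) := by
      rw [sum_erase_update z i x f]
      exact sum_eq_coe_sum_toReal (fun j _ => hf.1 j _) fun j _ => hf.ne_top hz j
    have h2 := hf.eq_sum hz
    rw [← Finset.add_sum_erase _ _ (Finset.mem_univ i)] at h2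
    convert EReal.coe_le_coe_iff.2 (show a ≤ cost (Function.update z i x) -
      ∑ j ∈ Finset.univ.erase i, (f j (z j)).toReal by
        rw [cost_update, real_inner_comm]; linarith) using 1
    rw [EReal.coe_sub, ← h1]
    congr!
  · refine iSup₂_le fun z hz => ?_
    subst hz
    convert hf.sub_sum_erase_le i z

lemma IsConjugateTuple.add_const {ι X : Type*} [Fintype ι] {c : (ι → X) → ℝ}
    {f h : ι → X → EReal} (hf : IsConjugateTuple c f) {ρ : ι → ℝ} (hρ : ∑ i, ρ i = 0)
    (hh : ∀ i x, h i x = f i x + (ρ i : EReal)) : IsConjugateTuple c h := by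
  classical
  refine ⟨fun i => ⟨fun x => ?_, ?_⟩, fun i x => ?_⟩
  · rw [hh, Ne, EReal.add_eq_bot_iff, not_or]
    exact ⟨(hf.1 i).1 x, EReal.coe_ne_bot _⟩
  · obtain ⟨x, hx⟩ := (hf.1 i).2
    exact ⟨x, by rw [hh]; exact (EReal.add_lt_top hx (EReal.coe_ne_top _)).ne⟩
  · rw [hh, hf.2 i x, ← iSup_add_coe]
    refine iSup_congr fun z => ?_
    by_cases hz : z i = x
    · simp only [hz, iSup_pos]
      have hr : ∑ j ∈ Finset.univ.erase i, ρ j = -ρ i := by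
        have := Finset.add_sum_erase _ ρ (Finset.mem_univ i)
        linarith
      simp only [hh, Finset.sum_add_distrib]
      rw [← coe_sum_real]
      have hb : ∑ j ∈ Finset.univ.erase i, f j (z j) ≠ ⊥ := sum_ne_bot fun j _ => (hf.1 j).1 _
      convert_to (c z : EReal) - ∑ j ∈ Finset.univ.erase i, f j (z j) + (ρ i : EReal) =
        (c z : EReal) - (∑ j ∈ Finset.univ.erase i, f j (z j) +
          ((∑ j ∈ Finset.univ.erase i, ρ j : ℝ) : EReal))
      rw [hr]
      generalize ∑ j ∈ Finset.univ.erase i, f j (z j) = S at hb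
      induction S with
      | bot => exact absurd rfl hb
      | top => simp
      | coe S => norm_cast; ring
    -- An inadmissible `z` contributes `⊥` to both suprema.
    · simp [hz]

lemma IsSplittingTuple.add_const {ι X : Type*} [Fintype ι] {c : (ι → X) → ℝ} {Γ : Set (ι → X)}
    {f h : ι → X → EReal} (hf : IsSplittingTuple c Γ f) {ρ : ι → ℝ} (hρ : ∑ i, ρ i = 0)
    (hh : ∀ i x, h i x = f i x + (ρ i : EReal)) : IsSplittingTuple c Γ h := by
  have hs : ∀ x : ι → X, ∑ i, h i (x i) = ∑ i, f i (x i) := fun x => by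
    simp only [hh, Finset.sum_add_distrib]
    rw [← coe_sum_real, hρ, EReal.coe_zero, add_zero]
  refine ⟨fun i x => ?_, fun x => by rw [hs]; exact hf.2.1 x, fun x hx => by
    rw [hs]; exact hf.2.2 x hx⟩
  rw [hh, Ne, EReal.add_eq_bot_iff, not_or]
  exact ⟨hf.1 i x, EReal.coe_ne_bot _⟩

/-- Uniqueness, up to constants, of conjugate splitting tuples. -/
lemma IsConjugateTuple.exists_eq_add_const [CompleteSpace H] {h : Fin N → H → EReal}
    (hne : Γ.Nonempty) (hf : IsSplittingTuple cost Γ f) (hproper : ∀ i, IsProper (f i))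
    (hconvex : ∀ i, IsConvex (f i)) (hlsc : ∀ i, LowerSemicontinuous (f i))
    (hsub : ∀ i a, subdifferential (f i) a ⊆ marginalMap Γ i a) {P : Fin N → H → H}
    (hP : ∀ i s, s - P i s ∈ subdifferential (f i) (P i s))
    (hconj : IsConjugateTuple cost h) (hh : IsSplittingTuple cost Γ h) :
    ∃ ρ : Fin N → ℝ, ∑ i, ρ i = 0 ∧ ∀ i x, h i x = f i x + (ρ i : EReal) := by
  classical
  obtain ⟨x₀, hx₀⟩ := hne
  have hsub' : ∀ i a, subdifferential (f i) a ⊆ subdifferential (h i) a := fun i a =>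
    (hsub i a).trans (hh.marginalMap_subset hconj.1 i a)
  have hdiff : ∀ i a w, w ∈ subdifferential (f i) a →
      (h i a).toReal - (f i a).toReal = (h i (x₀ i)).toReal - (f i (x₀ i)).toReal := by
    -- Since `∂f_i ⊆ ∂h_i`, the map `P i` is a resolvent for both functions. At a common proximal
    -- point the `proxValue`s differ by `h_i - f_i`.
    have key : ∀ i s t, proxValue (f i) s (P i s) - proxValue (h i) s (P i s) =
        proxValue (f i) t (P i t) - proxValue (h i) t (P i t) := fun i =>
      sub_eq_sub_of_common_subgradient (norm_resolvent_bound (hproper i) (hP i))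
        (proxValue_add_le (hproper i) (hP i))
        (proxValue_add_le (hconj.1 i) fun s => hsub' i _ (hP i s))
    have hres : ∀ i a w, w ∈ subdifferential (f i) a → P i (a + w) = a := fun i a w hw =>
      (isMonotoneMap_subdifferential (hproper i)).resolvent_unique (hP i (a + w)) (by simpa using hw)
    intro i a w hw
    have hw₀ := hf.sum_erase_mem_subdifferential hproper hx₀ i
    have h1 := key i (a + w) (x₀ i + ∑ j ∈ Finset.univ.erase i, x₀ j)
    rw [hres i a w hw, hres i _ _ hw₀] at h1
    simp only [proxValue] at h1
    linarith
  let ρ : Fin N → ℝ := fun i => (h i (x₀ i)).toReal - (f i (x₀ i)).toReal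
  have hρ : ∑ i, ρ i = 0 := by
    simp only [ρ, Finset.sum_sub_distrib]
    rw [← hf.eq_sum hx₀, ← hh.eq_sum hx₀, sub_self]
  have hle : ∀ i x, f i x + (ρ i : EReal) ≤ h i x := by
    intro i x
    rw [← EReal.le_sub_iff_add_le (Or.inl (EReal.coe_ne_bot _)) (Or.inl (EReal.coe_ne_top _))]
    refine EReal.ge_of_forall_gt_iff_ge.1 fun a ha => ?_
    rw [EReal.le_sub_iff_add_le (Or.inl (EReal.coe_ne_bot _)) (Or.inl (EReal.coe_ne_top _))]
    obtain ⟨p, w, hw, haw⟩ := (hconvex i).exists_subgradient_ge (hproper i) (hlsc i)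
      (hf.sum_erase_mem_subdifferential hproper hx₀ i) ha
    by_cases hx : h i x = ⊤
    · rw [hx]; exact le_top
    have h1 := subgradient_le (hconj.1 i) (hsub' i p hw) hx
    have h2 := hdiff i p w hw
    rw [← EReal.coe_toReal hx (hh.1 i x), ← EReal.coe_add, EReal.coe_le_coe_iff]
    simp only [ρ]
    linarith
  have hfρ : IsSplittingTuple cost Γ fun i x => f i x + (ρ i : EReal) :=
    hf.add_const hρ fun _ _ => rfl
  refine ⟨ρ, hρ, fun i x => le_antisymm ?_ (hle i x)⟩
  -- Conjugation reverses order, so the lower bounds `hle` on the other entries bound `h i` from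
  -- above.
  rw [hconj.2 i x]
  refine iSup₂_le fun z hz => ?_
  subst hz
  refine le_trans ?_ (hfρ.sub_sum_erase_le i z)
  convert EReal.sub_le_sub (le_refl (cost z : EReal)) (Finset.sum_le_sum fun j _ => hle j (z j))

end Cost

end MultiMarginal

theorem theorem4p3 {H : Type*} [NormedAddCommGroup H] [InnerProductSpace ℝ H] [CompleteSpace H]
    {N : ℕ} (hN : 2 ≤ N) (f : Fin N → H → EReal)
    (hproper : ∀ i, MultiMarginal.IsProper (f i))
    (hconvex : ∀ i, MultiMarginal.IsConvex (f i))
    (hlsc : ∀ i, LowerSemicontinuous (f i))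
    (Γ : Set (Fin N → H)) (hne : Γ.Nonempty)
    (hΓ : MultiMarginal.IsSplittingSetGeneratedBy MultiMarginal.cost Γ f) :
    List.TFAE [
      ∃ i₀, MultiMarginal.IsMaximallyMonotoneMap (MultiMarginal.marginalMap Γ i₀),
      ∃ i₀, MultiMarginal.marginalMap Γ i₀ = MultiMarginal.subdifferential (f i₀),
      ∀ i, MultiMarginal.marginalMap Γ i = MultiMarginal.subdifferential (f i),
      ∀ s : H, ∑ i, MultiMarginal.prox (f i) s = s,
      ∀ s : H, ∑ i, MultiMarginal.moreauEnvelope (MultiMarginal.conjugate (f i)) s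
        = ((MultiMarginal.q s : ℝ) : EReal)] ∧
    ((∃ i₀, MultiMarginal.IsMaximallyMonotoneMap (MultiMarginal.marginalMap Γ i₀)) →
      MultiMarginal.IsMaximallyMonotoneSet MultiMarginal.cost Γ ∧
      MultiMarginal.IsMaximallyCyclicallyMonotone MultiMarginal.cost Γ ∧
      MultiMarginal.IsConjugateTuple MultiMarginal.cost f ∧
      MultiMarginal.IsSplittingTuple MultiMarginal.cost Γ f ∧
      ∀ h : Fin N → H → EReal,
        (MultiMarginal.IsConjugateTuple MultiMarginal.cost h ∧
          MultiMarginal.IsSplittingTuple MultiMarginal.cost Γ h) ↔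
        ∃ ρ : Fin N → ℝ, ∑ i, ρ i = 0 ∧ ∀ i x, h i x = f i x + ((ρ i : ℝ) : EReal)) := by
  open MultiMarginal in
  have hf := hΓ.isSplittingTuple
  obtain ⟨x₀, hx₀⟩ := id hne
  have hP : ∀ i s, s - prox (f i) s ∈ subdifferential (f i) (prox (f i) s) := fun i =>
    sub_prox_mem_subdifferential (hproper i) (hconvex i) (hlsc i)
      (hf.sum_erase_mem_subdifferential hproper hx₀ i)
  have hmono := fun i => isMonotoneMap_subdifferential (hproper i)
  have hmax : ∀ i, IsMaximallyMonotoneMap (subdifferential (f i)) := fun i =>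
    (hmono i).isMaximallyMonotoneMap fun s => ⟨_, hP i s⟩
  have tfae : List.TFAE [
      ∃ i₀, IsMaximallyMonotoneMap (marginalMap Γ i₀),
      ∃ i₀, marginalMap Γ i₀ = subdifferential (f i₀),
      ∀ i, marginalMap Γ i = subdifferential (f i),
      ∀ s : H, ∑ i, prox (f i) s = s,
      ∀ s : H, ∑ i, moreauEnvelope (conjugate (f i)) s = ((q s : ℝ) : EReal)] := by
    tfae_have 1 → 2
    | ⟨i, hi⟩ => ⟨i, (hi.2 _ (hmono i) (hf.marginalMap_subset hproper i)).symm⟩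
    tfae_have 2 → 1
    | ⟨i, hi⟩ => ⟨i, hi ▸ hmax i⟩
    tfae_have 3 → 2
    | h => ⟨⟨0, by omega⟩, h _⟩
    tfae_have 2 → 4
    | ⟨i, hi⟩, s => by
      -- A single index suffices: it produces `x ∈ Γ` with sum `s`, and then all coordinates of `x`
      -- are proximal points of `s`.
      have hs := hP i s
      rw [← hi] at hs
      obtain ⟨x, hx, hxi, hxs⟩ := hs
      have hsum : ∑ j, x j = s := by
        rw [← Finset.add_sum_erase _ x (Finset.mem_univ i), hxs, hxi]; abel
      rw [← hsum]
      refine Finset.sum_congr rfl fun j _ => (hmono j).resolvent_unique (hP j _) ?_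
      rw [← sum_erase_eq_sub]
      exact hf.sum_erase_mem_subdifferential hproper hx j
    tfae_have 4 → 3
    | h, i => by
      funext a
      refine Set.Subset.antisymm (hf.marginalMap_subset hproper i a) fun w hw => ?_
      -- The proximal tuple of `a + w` is in `Γ`; its `i`-th entry is `a`, so the others sum to `w`.
      have hi : prox (f i) (a + w) = a :=
        (hmono i).resolvent_unique (hP i (a + w)) (by simpa using hw)
      refine ⟨_, hΓ.prox_mem hproper hne hP h (a + w), hi, ?_⟩
      rw [sum_erase_eq_sub fun j => prox (f j) (a + w)]
      simp [h, hi]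
    tfae_have 4 ↔ 5 := by
      have henv : ∀ s, ∑ i, moreauEnvelope (conjugate (f i)) s =
          ((∑ i, proxValue (f i) s (prox (f i) s) : ℝ) : EReal) := fun s => by
        rw [coe_sum_real]
        exact Finset.sum_congr rfl fun i _ => moreauEnvelope_conjugate_eq (hproper i) (hP i s)
      simp only [henv, EReal.coe_eq_coe_iff]
      exact ⟨hf.sum_proxValue_eq_q hproper hne hP, sum_eq_of_sum_proxValue_eq_q hproper hP⟩
    tfae_finish
  refine ⟨tfae, fun h1 => ?_⟩
  have h3 := (tfae.out 0 2).1 h1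
  have h4 := (tfae.out 0 3).1 h1
  have hsub : ∀ i a, subdifferential (f i) a ⊆ marginalMap Γ i a := fun i a => (h3 i ▸ subset_rfl)
  have hmaxΓ : IsMaximallyMonotoneSet cost Γ :=
    hf.isMaximallyMonotoneSet hproper hP (hΓ.prox_mem hproper hne hP h4) fun i => h3 i ▸ hmax i
  have hconj := hf.isConjugateTuple hne hproper hconvex hlsc hsub
  exact ⟨hmaxΓ, hmaxΓ.isMaximallyCyclicallyMonotone hf, hconj, hf, fun h =>
    ⟨fun hh => hh.1.exists_eq_add_const hne hf hproper hconvex hlsc hsub hP hh.2,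
      fun ⟨ρ, hρ, hh⟩ => ⟨hconj.add_const hρ hh, hf.add_const hρ hh⟩⟩⟩
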